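/- Let $X$ be a countable set and let $p:X\times X\to[0,1]$ be a transition function, $\sum_y p(x,y)=1$ for all $x$. Let $p^n$ be its iterates ($p^0(x,y)=\delta_x(y)$, $p^{n+1}(x,y)=\sum_z p(x,z)p^n(z,y)$) and $G(x,y)=\sum_{n\ge 0}p^n(x,y)$. Let $\mathbf P_x$ be the law on the space of sample paths $X^{\mathbb Z_+}$ of the Markov chain with transition function $p$ started at $x$, and let $S(x_0,x_1,\dots)=(x_1,x_2,\dots)$ be the shift. Assume that $p$ is transient, i.e. $G(x,y)<\infty$ for all $x,y\in X$, and that there is $o\in X$ with $G(o,y)>0$ for all $y\in X$. Let $\tau:X^{\mathbb Z_+}\to\mathbb Z_+\cup\{\infty\}$ be a stopping time for the filtration generated by the coordinates, with $\mathbf P_x(\tau<\infty)=1$ for all $x\in X$. Put $\tau_0=0$ and $\tau_{n+1}=\tau_n+\tau\circ S^{\tau_n}$ (and $\tau_{n+1}=\infty$ where $\tau_n=\infty$), and $p^\tau(x,y)=\mathbf P_x(\tau<\infty,\ x_\tau=y)$. Assume that $\tau$ can be asymptotically recovered: there is a measurable map $\rho:X^{\mathbb Z_+}\to\mathbb Z_+$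 such that $$\limsup_{n\to\infty}\ \inf_{x\in X}\ \mathbf P_x\bigl(n+\rho\circ S^n\in\{\tau_0,\tau_1,\tau_2,\dots\}\bigr)=1 .$$ Let $u:X\to\mathbb R$ be nonnegative, bounded and $p^\tau$-harmonic, i.e. $\sum_y p^\tau(x,y)u(y)=u(x)$ for all $x$. Then there is a function $\bar u:X\times\mathbb Z_+\to\mathbb R$ such that 1. $\bar u(x,0)=u(x)$ for all $x\in X$; 2. $\bar u$ is nonnegative and bounded, and it is a $p$-harmonic sequence: $\sum_y p(x,y)\,\bar u(y,n+1)=\bar u(x,n)$ for all $x\in X$, $n\in\mathbb Z_+$; 3. $\|\bar u\|_\infty=\|u\|_\infty$ (supremum norms); 4. if $p$ is steady, then $\bar u(x,n)=u(x)$ for all $x\in X$ and $n\in\mathbb Z_+$. In particular, if $p$ is steady, then $u$ is $p$-harmonic. Here $p$ is called steady if the tail $\sigma$-algebra $\bigcap_{k\ge0}S^{-k}\mathcal F$ and the invariant $\sigma$-algebra $\{A\in\mathcal F: S^{-1}A=A\}$, where $\mathcal F$ is the product $\sigma$-algebra on $X^{\mathbb Z_+}$, have the same completion with respect to the sets that are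 null for all $\mathbf P_x$, $x\in X$ (equivalently, null for $\mathbf P_\theta$ with an initial distribution $\theta$ of full support). -/

import Mathlib

open MeasureTheory ProbabilityTheory Filter
open scoped ENNReal

/-! Markov chains on a countable state space `X` (with the discrete sigma-algebra). A transition
function is a map `p : X → PMF X`, where `p x y` is the probability of a step from `x` to `y`.
The space of sample paths is `ℕ → X` with the product sigma-algebra. -/

namespace MarkovStopping

noncomputable section

open Classical in
/-- The iterates of a transition function:
`p⁰ (x, y) = δ_x (y)` and `pⁿ⁺¹ (x, y) = ∑_z p (x, z) pⁿ (z, y)`. -/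
def iterate {X : Type*} (p : X → PMF X) : ℕ → X → X → ℝ≥0∞
  | 0, x, y => if x = y then 1 else 0
  | n + 1, x, y => ∑' z, p x z * iterate p n z y

/-- The Green function `G (x, y) = ∑_{n ≥ 0} pⁿ (x, y)`, with values in `[0, ∞]`. -/
def green {X : Type*} (p : X → PMF X) (x y : X) : ℝ≥0∞ := ∑' n, iterate p n x y

/-- `p` is transient when its Green function is finite. -/
def IsTransient {X : Type*} (p : X → PMF X) : Prop := ∀ x y, green p x y < ∞

/-- `f` is harmonic for `q`: for every `x` the sum `∑_y q (x, y) f (y)` converges (absolutely,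
since `HasSum` is unconditional) and equals `f x`. -/
def IsHarmonic {X : Type*} (q : X → X → ℝ≥0∞) (f : X → ℝ) : Prop :=
  ∀ x, HasSum (fun y => (q x y).toReal * f y) (f x)

/-- A function `f` on `X × ℕ`, seen as the sequence `f_n = f (·, n)`, is a `p`-harmonic sequence
when `p f_{n+1} = f_n` for every `n` (all the sums being absolutely convergent). -/
def IsHarmonicSeq {X : Type*} (p : X → PMF X) (f : X × ℕ → ℝ) : Prop :=
  ∀ x n, HasSum (fun y => (p x y).toReal * f (y, n + 1)) (f (x, n))

/-- Bounded real functions. -/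
def IsBdd {α : Type*} (f : α → ℝ) : Prop := ∃ C : ℝ, ∀ a, |f a| ≤ C

/-- The supremum norm (meaningful for bounded functions). -/
def supNorm {α : Type*} (f : α → ℝ) : ℝ := ⨆ a, |f a|

/-- The time shift `S^k` on sample paths. -/
def shift {X : Type*} (k : ℕ) (ω : ℕ → X) : ℕ → X := fun n => ω (k + n)

/-- The iterations of a stopping time: `τ_0 = 0` and `τ_{n+1} = τ_n + τ ∘ S^{τ_n}`
(which is `∞` where `τ_n = ∞`). -/
def iterTime {X : Type*} (τ : (ℕ → X) → ℕ∞) : ℕ → (ℕ → X) → ℕ∞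
  | 0, _ => 0
  | n + 1, ω => iterTime τ n ω + τ (shift (iterTime τ n ω).toNat ω)

section Measurable

variable {X : Type*} [MeasurableSpace X] [DiscreteMeasurableSpace X] [Countable X]

/-- The Markov kernel on `X` given by a transition function. -/
def stepKernel (p : X → PMF X) : Kernel X X where
  toFun x := (p x).toMeasure
  measurable' := measurable_of_countable _

instance (p : X → PMF X) : IsMarkovKernel (stepKernel p) :=
  ⟨fun x => PMF.toMeasure.isProbabilityMeasure (p x)⟩

/-- The law of the next state given the states up to time `n`: it depends on the last one only. -/
def historyKernel (p : X → PMF X) (n : ℕ) : Kernel ((i : Finset.Iic n) → (fun _ : ℕ => X) i) X :=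
  (stepKernel p).comap (fun h => h ⟨n, Finset.mem_Iic.2 le_rfl⟩) (measurable_pi_apply _)

instance (p : X → PMF X) (n : ℕ) : IsMarkovKernel (historyKernel p n) := by
  unfold historyKernel; infer_instance

/-- `P_x`: the law on the space of sample paths of the Markov chain with transition function `p`
started at `x`, built by the Ionescu-Tulcea theorem. -/
def pathMeasure (p : X → PMF X) (x : X) : Measure (ℕ → X) :=
  Kernel.traj (X := fun _ : ℕ => X) (fun n => historyKernel p n) 0 (fun _ => x)

instance (p : X → PMF X) (x : X) : IsProbabilityMeasure (pathMeasure p x) := by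
  unfold pathMeasure; infer_instance

/-- Stopping times with values in `ℕ ∪ {∞}`, for the filtration
`σ(ω_0, ..., ω_n)` generated by the coordinates. -/
def IsPathStoppingTime (τ : (ℕ → X) → ℕ∞) : Prop :=
  IsStoppingTime (Filtration.piLE (X := fun _ : ℕ => X)) τ

/-- The transformed transition function `p^τ (x, y) = P_x (x_τ = y)`. -/
def transformed (p : X → PMF X) (τ : (ℕ → X) → ℕ∞) (x y : X) : ℝ≥0∞ :=
  pathMeasure p x {ω | ∃ k : ℕ, τ ω = k ∧ ω k = y}

/-- `τ` can be asymptotically recovered: there is a (measurable) `ρ ≥ 0` on sample paths with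
`limsup_n inf_x P_x (n + ρ ∘ S^n ∈ {τ_0, τ_1, ...}) = 1`. -/
def AsymptoticallyRecovered (p : X → PMF X) (τ : (ℕ → X) → ℕ∞) : Prop :=
  ∃ ρ : (ℕ → X) → ℕ, Measurable ρ ∧
    limsup (fun n : ℕ => ⨅ x, pathMeasure p x
      {ω | ∃ k : ℕ, iterTime τ k ω = ((n + ρ (shift n ω) : ℕ) : ℕ∞)}) atTop = 1

/-- The invariant sigma-algebra: measurable sets `A` with `S⁻¹ A = A`. -/
abbrev invariantSigma (X : Type*) [MeasurableSpace X] : MeasurableSpace (ℕ → X) :=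
  MeasurableSpace.invariants (shift 1)

/-- The tail sigma-algebra `⋂_k S^{-k} (F)`. -/
abbrev tailSigma (X : Type*) [MeasurableSpace X] : MeasurableSpace (ℕ → X) :=
  ⨅ k : ℕ, MeasurableSpace.comap (shift k) MeasurableSpace.pi

/-- The completion of a sigma-algebra `𝒢` on sample paths with respect to the sets that are
null for all the `P_x` (equivalently null for `P_θ`, if `θ` is an initial distribution of full
support): the sets that differ from a member of `𝒢` by such a null set. -/
def completion (p : X → PMF X) (𝒢 : MeasurableSpace (ℕ → X)) : Set (Set (ℕ → X)) :=
  {A | ∃ B, MeasurableSet[𝒢] B ∧ ∀ x, pathMeasure p x (symmDiff A B) = 0}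

/-- `p` is steady when the tail boundary and the Poisson boundary coincide: the tail and the
invariant sigma-algebras have the same completion. -/
def IsSteady (p : X → PMF X) : Prop :=
  completion p (tailSigma X) = completion p (invariantSigma X)

end Measurable

end

end MarkovStopping

/-! Write `P_x`, `E_x` for the chain started at `x`. Since `u` is bounded and `p^τ`-harmonic, the
strong Markov property makes `u(x_{τ_k})` a bounded martingale under every `P_x`. It converges
almost surely to `U = stoppedLim τ u`, and `E_x U = u(x)` (`integral_stoppedLim`). Dropping finitely
many of the times `τ_k` does not change the limit, so `U ∘ S^t = U` whenever `t` is one of them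
(`stoppedLim_shift`).

Recovery turns `U` into a tail function. With `W = U ∘ S^ρ`, one has `W ∘ S^n = U` on the event that
`n + ρ ∘ S^n` is some `τ_k`. Along a sparse sequence `φ`, the same for all `x`, the exceptional
events have summable probabilities, so by Borel–Cantelli `W ∘ S^{φ j} = U` for all large `j`
(`AsymptoticallyRecovered.exists_tail_version`).

Put `V_n = limsup_j W ∘ S^{φ j - n}`. Then `V_0 = U` almost surely and `V_{n+1} ∘ S = V_n`, so the
Markov property makes `E_x V_n` a `p`-harmonic sequence that starts at `u`. It stays in `[0, ‖u‖]`
because `W` does. If `p` is steady, the tail function `V_0` is almost surely shift invariant, and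
the one-step Markov property for `V_0` says that `u` itself is `p`-harmonic. -/

namespace MarkovStopping

/-! ### Time homogeneity and the Markov property of the path measures. -/

section Markov

variable {X : Type*} [MeasurableSpace X] [DiscreteMeasurableSpace X] [Countable X]

lemma measurable_shift {Y : Type*} [MeasurableSpace Y] (k : ℕ) :
    Measurable (shift k : (ℕ → Y) → ℕ → Y) :=
  measurable_pi_lambda _ fun n => measurable_pi_apply (k + n)

lemma shift_shift {Y : Type*} (m n : ℕ) (ω : ℕ → Y) : shift m (shift n ω) = shift (n + m) ω := by
  funext i; simp only [shift]; congr 1; omega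

lemma shift_zero {Y : Type*} (ω : ℕ → Y) : shift 0 ω = ω := by
  funext i; simp [shift]

/-- The law of the trajectory starting from the history `h` up to time `b`. -/
noncomputable abbrev trajFrom (p : X → PMF X) (b : ℕ) :
    Kernel ((i : Finset.Iic b) → (fun _ : ℕ => X) i) (ℕ → X) :=
  Kernel.traj (X := fun _ : ℕ => X) (fun n => historyKernel p n) b

lemma trajFrom_ae_eq (p : X → PMF X) (b : ℕ) (h : (i : Finset.Iic b) → (fun _ : ℕ => X) i) :
    ∀ᵐ ω ∂(trajFrom p b h), ω b = h ⟨b, Finset.mem_Iic.2 le_rfl⟩ := by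
  have h1 : (trajFrom p b h).map (Preorder.frestrictLe b) = Measure.dirac h := by
    rw [Kernel.traj_map_frestrictLe_apply, Kernel.partialTraj_self, Kernel.id_apply]
  have h2 : ∀ᵐ g ∂((trajFrom p b h).map (Preorder.frestrictLe b)), g = h := by
    rw [h1, ae_dirac_eq]; rfl
  have h3 := ae_of_ae_map (Preorder.measurable_frestrictLe b).aemeasurable h2
  filter_upwards [h3] with ω hω
  rw [← hω]; rfl

/-- Condition on the step from time `b` to `b + 1`; this is the induction step for cylinder
probabilities. -/
lemma trajFrom_apply_eq_lintegral (p : X → PMF X) (b : ℕ)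
    (h : (i : Finset.Iic b) → (fun _ : ℕ => X) i) {C : Set (ℕ → X)} (hC : MeasurableSet C)
    (F : X → ℝ≥0∞)
    (hF : ∀ h', trajFrom p (b + 1) h' C = F (h' ⟨b + 1, Finset.mem_Iic.2 le_rfl⟩)) :
    trajFrom p b h C = ∫⁻ y, F y ∂(p (h ⟨b, Finset.mem_Iic.2 le_rfl⟩)).toMeasure := by
  have hFm : Measurable F := measurable_of_countable _
  rw [trajFrom, ← Kernel.traj_comp_partialTraj (Nat.le_succ b), Kernel.comp_apply' _ _ _ hC]
  simp only [Nat.succ_eq_add_one]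
  have e : historyKernel p b h = (p (h ⟨b, Finset.mem_Iic.2 le_rfl⟩)).toMeasure := rfl
  rw [← e, ← Kernel.map_partialTraj_succ_self (X := fun _ : ℕ => X)
    (κ := fun n => historyKernel p n) b, Kernel.map_apply _ (measurable_pi_apply _),
    lintegral_map hFm (measurable_pi_apply _)]
  exact lintegral_congr fun h' => hF h'

lemma measurableSet_cylinder {Y : Type*} [MeasurableSpace Y] [MeasurableSingletonClass Y]
    (b m : ℕ) (a : ℕ → Y) :
    MeasurableSet {ω : ℕ → Y | ∀ i ≤ m, ω (b + i) = a i} := by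
  simp only [Set.ofPred_forall]
  exact MeasurableSet.iInter fun i => MeasurableSet.iInter fun _ =>
    (measurableSet_singleton (a i)).preimage (measurable_pi_apply (b + i))

/-- The law of `m + 1` consecutive states from time `b` on depends on the state at time `b` only,
and in the same way for all `b`. -/
lemma exists_trajFrom_cylinder (p : X → PMF X) (m : ℕ) (a : ℕ → X) :
    ∃ F : X → ℝ≥0∞, ∀ (b : ℕ) (h : (i : Finset.Iic b) → (fun _ : ℕ => X) i),
      trajFrom p b h {ω | ∀ i ≤ m, ω (b + i) = a i} = F (h ⟨b, Finset.mem_Iic.2 le_rfl⟩) := by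
  classical
  induction m generalizing a with
  | zero =>
    refine ⟨fun x => if x = a 0 then 1 else 0, fun b h => ?_⟩
    have h0 := trajFrom_ae_eq p b h
    dsimp only
    split_ifs with hx
    · rw [← measure_univ (μ := trajFrom p b h)]
      refine measure_congr ?_
      filter_upwards [h0] with ω hω
      refine propext ⟨fun _ => trivial, fun _ i hi => ?_⟩
      obtain rfl : i = 0 := by omega
      exact hω.trans hx
    · refine measure_mono_null (fun ω hω => ?_) h0
      intro h1
      exact hx (h1.symm.trans (hω 0 le_rfl))
  | succ m ih =>
    obtain ⟨F, hF⟩ := ih (fun i => a (i + 1))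
    -- The state at time `b` must be `a 0`; the other constraints form a cylinder of length `m`
    -- starting at time `b + 1`, to which `ih` applies for the shifted word.
    refine ⟨fun x => if x = a 0 then ∫⁻ y, F y ∂(p x).toMeasure else 0, fun b h => ?_⟩
    have h0 := trajFrom_ae_eq p b h
    dsimp only
    split_ifs with hx
    · rw [← trajFrom_apply_eq_lintegral p b h
        (measurableSet_cylinder (b + 1) m fun i => a (i + 1)) F (hF (b + 1))]
      refine measure_congr ?_
      filter_upwards [h0] with ω hω
      refine propext ⟨fun H i hi => ?_, fun H i hi => ?_⟩
      · have := H (i + 1) (by omega)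
        rwa [show b + 1 + i = b + (i + 1) by omega]
      · cases i with
        | zero => exact hω.trans hx
        | succ i =>
          have := H i (by omega)
          rwa [show b + 1 + i = b + (i + 1) by omega] at this
    · refine measure_mono_null (fun ω hω => ?_) h0
      intro h1
      exact hx (h1.symm.trans (hω 0 (Nat.zero_le _)))

/-- As `X` is countable, the law of the first `m + 1` states is determined by its atoms, and a
measure on paths is the unique projective limit of its finite-dimensional laws. -/
lemma measure_ext_of_cylinder {μ ν : Measure (ℕ → X)} [IsProbabilityMeasure μ]
    [IsProbabilityMeasure ν]
    (H : ∀ (m : ℕ) (a : ℕ → X), μ {ω | ∀ i ≤ m, ω i = a i} = ν {ω | ∀ i ≤ m, ω i = a i}) :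
    μ = ν := by
  have key : ∀ m : ℕ, μ.map (Preorder.frestrictLe (π := fun _ : ℕ => X) m) =
      ν.map (Preorder.frestrictLe m) := by
    intro m
    refine Measure.ext_of_singleton fun a => ?_
    have hm := measurableSet_singleton a
    rw [Measure.map_apply (Preorder.measurable_frestrictLe m) hm,
      Measure.map_apply (Preorder.measurable_frestrictLe m) hm]
    -- Values beyond `m` are arbitrary: the cylinder does not see them.
    let a' : ℕ → X := fun i => if hi : i ≤ m then a ⟨i, Finset.mem_Iic.2 hi⟩
      else a ⟨m, Finset.mem_Iic.2 le_rfl⟩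
    have hs : Preorder.frestrictLe (π := fun _ : ℕ => X) m ⁻¹' {a} =
        {ω | ∀ i ≤ m, ω i = a' i} := by
      ext ω
      simp only [Set.mem_preimage, Set.mem_singleton_iff, funext_iff, Set.mem_ofPred_eq]
      constructor
      · intro h i hi
        have := h ⟨i, Finset.mem_Iic.2 hi⟩
        simpa [a', hi] using this
      · rintro h ⟨i, hi⟩
        have hi' := Finset.mem_Iic.1 hi
        have := h i hi'
        simpa [a', hi'] using this
    rw [hs, H]
  refine IsProjectiveLimit.unique (P := fun I => ν.map I.restrict) (fun I => ?_) fun I => rfl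
  have hI : I ⊆ Finset.Iic (I.sup id) := I.subset_Iic_sup_id
  have := congrArg (Measure.map (Finset.restrict₂ (π := fun _ : ℕ => X) hI)) (key (I.sup id))
  rwa [Measure.map_map (Finset.measurable_restrict₂ hI) (Preorder.measurable_frestrictLe _),
    Measure.map_map (Finset.measurable_restrict₂ hI) (Preorder.measurable_frestrictLe _)] at this

/-- Shifting by `b` the trajectory with history `h` up to time `b` gives the chain started at
the last state of `h`. -/
lemma trajFrom_map_shift (p : X → PMF X) (b : ℕ) (h : (i : Finset.Iic b) → (fun _ : ℕ => X) i) :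
    (trajFrom p b h).map (shift b) = pathMeasure p (h ⟨b, Finset.mem_Iic.2 le_rfl⟩) := by
  have := Measure.isProbabilityMeasure_map (μ := trajFrom p b h) (measurable_shift b).aemeasurable
  refine measure_ext_of_cylinder fun m a => ?_
  obtain ⟨F, hF⟩ := exists_trajFrom_cylinder p m a
  have hm := measurableSet_cylinder 0 m a
  simp only [zero_add] at hm
  rw [Measure.map_apply (measurable_shift b) hm]
  refine (hF b h).trans ?_
  have h0 := hF 0 (fun _ => h ⟨b, Finset.mem_Iic.2 le_rfl⟩)
  simp only [zero_add] at h0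
  exact h0.symm

lemma pathMeasure_ae_zero (p : X → PMF X) (x : X) : ∀ᵐ ω ∂(pathMeasure p x), ω 0 = x :=
  trajFrom_ae_eq p 0 fun _ => x

/-- The Markov property at a deterministic time. -/
lemma setIntegral_shift (p : X → PMF X) (x : X) (n : ℕ) {f : (ℕ → X) → ℝ} (hf : Measurable f)
    {C : ℝ} (hC : ∀ ω, |f ω| ≤ C) {A : Set (ℕ → X)}
    (hA : MeasurableSet[Filtration.piLE (X := fun _ : ℕ => X) n] A) :
    ∫ ω in A, f (shift n ω) ∂(pathMeasure p x) =
      ∫ ω in A, (∫ η, f η ∂(pathMeasure p (ω n))) ∂(pathMeasure p x) := by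
  have hfs : Measurable fun ω => f (shift n ω) := hf.comp (measurable_shift n)
  have hint : Integrable (fun ω => f (shift n ω)) (pathMeasure p x) :=
    Integrable.of_bound hfs.aestronglyMeasurable C (ae_of_all _ fun ω => hC _)
  rw [← setIntegral_condExp (Filtration.piLE.le n) hint hA]
  refine setIntegral_congr_ae (Filtration.piLE.le n _ hA) ?_
  have hcond : (pathMeasure p x)[fun ω => f (shift n ω) | Filtration.piLE (X := fun _ : ℕ => X) n]
      =ᵐ[pathMeasure p x] fun ω => ∫ η, f (shift n η) ∂(trajFrom p n (Preorder.frestrictLe n ω)) :=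
    Kernel.condExp_traj (Nat.zero_le n) hint
  filter_upwards [hcond] with ω hω _
  rw [hω]
  have := trajFrom_map_shift p n (Preorder.frestrictLe n ω)
  rw [show ω n = Preorder.frestrictLe (π := fun _ : ℕ => X) n ω ⟨n, Finset.mem_Iic.2 le_rfl⟩ from rfl,
    ← this, integral_map (measurable_shift n).aemeasurable hf.aestronglyMeasurable]

lemma hasSum_integral_countable (μ : Measure X) [IsFiniteMeasure μ] {f : X → ℝ} {C : ℝ}
    (hC : ∀ x, |f x| ≤ C) : HasSum (fun y => (μ {y}).toReal * f y) (∫ y, f y ∂μ) := by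
  have hint : Integrable f μ :=
    Integrable.of_bound (measurable_of_countable f).aestronglyMeasurable C (ae_of_all _ hC)
  rw [← Measure.sum_smul_dirac μ] at hint
  have := hasSum_integral_measure hint
  rw [Measure.sum_smul_dirac] at this
  simpa [integral_smul_measure] using this

lemma pathMeasure_map_one (p : X → PMF X) (x : X) :
    (pathMeasure p x).map (fun ω => ω 1) = (p x).toMeasure := by
  have := Kernel.map_traj_succ_self (X := fun _ : ℕ => X) (κ := fun n => historyKernel p n) (a := 0)
  have h2 := congrArg (fun κ => κ (fun _ => x)) this
  rw [Kernel.map_apply _ (measurable_pi_apply _)] at h2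
  exact h2

/-- The one-step Markov property. -/
lemma hasSum_integral_shift (p : X → PMF X) (x : X) {f : (ℕ → X) → ℝ} (hf : Measurable f)
    {C : ℝ} (hC : ∀ ω, |f ω| ≤ C) :
    HasSum (fun y => (p x y).toReal * ∫ η, f η ∂(pathMeasure p y))
      (∫ ω, f (shift 1 ω) ∂(pathMeasure p x)) := by
  have h1 := setIntegral_shift p x 1 hf hC MeasurableSet.univ
  rw [setIntegral_univ, setIntegral_univ] at h1
  rw [h1, ← integral_map (φ := fun ω : ℕ → X => ω 1)
    (f := fun y => ∫ η, f η ∂(pathMeasure p y)) (measurable_pi_apply 1).aemeasurable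
    (measurable_of_countable _).aestronglyMeasurable, pathMeasure_map_one]
  have h2 := hasSum_integral_countable (p x).toMeasure (C := C)
    (f := fun y => ∫ η, f η ∂(pathMeasure p y)) fun y => by
      have := norm_integral_le_of_norm_le_const (μ := pathMeasure p y) (f := f) (ae_of_all _ hC)
      simpa using this
  simpa only [PMF.toMeasure_apply_singleton _ _ (measurableSet_singleton _)] using h2

end Markov

/-! ### Additivity of the iterated times. -/

section IterTime

variable {Y : Type*}

/-- Restarting at `τ_m` reproduces the later times. This cocycle identity is what makes the limit
along the `τ_k` invariant under the shift by `τ_m`. -/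
lemma iterTime_add (τ : (ℕ → Y) → ℕ∞) {m t : ℕ} {ω : ℕ → Y} (h : iterTime τ m ω = t) (k : ℕ) :
    iterTime τ (m + k) ω = t + iterTime τ k (shift t ω) := by
  induction k with
  | zero => simp [iterTime, h]
  | succ k ih =>
    rw [← add_assoc, iterTime, iterTime, ih]
    rcases eq_or_ne (iterTime τ k (shift t ω)) ⊤ with h1 | h1
    · simp [h1]
    · lift iterTime τ k (shift t ω) to ℕ using h1 with s
      rw [← Nat.cast_add, ENat.toNat_natCast, ENat.toNat_natCast, shift_shift, Nat.cast_add, add_assoc]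

lemma iterTime_mono (τ : (ℕ → Y) → ℕ∞) : Monotone (iterTime τ) :=
  monotone_nat_of_le_succ fun _ _ => le_self_add

end IterTime

/-! ### Measurability at stopping times and the strong Markov property. -/

section StoppingTime

variable {Y : Type*} [MeasurableSpace Y]

lemma measurableSet_piLE_shift {m : ℕ} {A : Set (ℕ → Y)}
    (hA : MeasurableSet[Filtration.piLE (X := fun _ : ℕ => Y) m] A) (n : ℕ) :
    MeasurableSet[Filtration.piLE (X := fun _ : ℕ => Y) (n + m)] (shift n ⁻¹' A) := by
  obtain ⟨t, ht, rfl⟩ := hA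
  refine ⟨(fun (h : (i : Set.Iic (n + m)) → Y) (i : Set.Iic m) =>
    h ⟨n + i, Set.mem_Iic.2 (Nat.add_le_add_left (Set.mem_Iic.1 i.2) n)⟩) ⁻¹' t,
    ht.preimage (measurable_pi_lambda _ fun i => measurable_pi_apply _), rfl⟩

lemma isPathStoppingTime_iterTime {τ : (ℕ → Y) → ℕ∞} (hτ : IsPathStoppingTime τ) (k : ℕ) :
    IsPathStoppingTime (iterTime τ k) := by
  induction k with
  | zero => exact isStoppingTime_const _ 0
  | succ k ih =>
    refine isStoppingTime_of_measurableSet_eq fun i => ?_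
    -- Split by the value `j` of `τ_k`: the remaining `i - j` units are decided by the coordinates
    -- from `j` to `i`.
    have : {ω | iterTime τ (k + 1) ω = (i : ℕ∞)} = ⋃ j ∈ Finset.Iic i,
        ({ω | iterTime τ k ω = (j : ℕ∞)} ∩ shift j ⁻¹' {ω | τ ω = ((i - j : ℕ) : ℕ∞)}) := by
      ext ω
      simp only [Set.mem_ofPred_eq, Set.mem_iUnion, Set.mem_inter_iff, Set.mem_preimage,
        Finset.mem_Iic, iterTime]
      constructor
      · intro h
        have h1 : iterTime τ k ω ≠ ⊤ := fun h1 => by simp [h1] at h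
        lift iterTime τ k ω to ℕ using h1 with s hs
        rw [ENat.toNat_natCast] at h
        have h2 : τ (shift s ω) ≠ ⊤ := fun h2 => by simp [h2] at h
        lift τ (shift s ω) to ℕ using h2 with r hr
        have h3 : s + r = i := by exact_mod_cast h
        exact ⟨s, by omega, rfl, by rw [← hr]; congr 1; omega⟩
      · rintro ⟨j, hj, h1, h2⟩
        rw [h1, ENat.toNat_natCast, h2]
        exact_mod_cast Nat.add_sub_cancel' hj
    refine this ▸ MeasurableSet.biUnion (Set.to_countable _) fun j hj => ?_
    have hj' : j ≤ i := Finset.mem_Iic.1 hj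
    refine MeasurableSet.inter ?_ ?_
    · exact Filtration.mono _ hj' _ (ih.measurableSet_eq_of_countable j)
    · have := measurableSet_piLE_shift (hτ.measurableSet_eq_of_countable (i - j)) j
      rwa [Nat.add_sub_cancel' hj'] at this

lemma measurableSet_eq_nat {σ : (ℕ → Y) → ℕ∞} (hσ : IsPathStoppingTime σ) (n : ℕ) :
    MeasurableSet {ω | σ ω = n} :=
  Filtration.piLE.le n _ (hσ.measurableSet_eq_of_countable n)

lemma measurableSet_eq_top {σ : (ℕ → Y) → ℕ∞} (hσ : IsPathStoppingTime σ) :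
    MeasurableSet {ω | σ ω = ⊤} := by
  have : {ω | σ ω = ⊤} = (⋃ n : ℕ, {ω | σ ω = n})ᶜ := by
    ext ω
    simp only [Set.mem_ofPred_eq, Set.mem_compl_iff, Set.mem_iUnion, not_exists]
    constructor
    · intro h n; simp [h]
    · intro h
      by_contra h1
      exact h _ (ENat.natCast_toNat h1).symm
  rw [this]
  exact (MeasurableSet.iUnion fun n => measurableSet_eq_nat hσ n).compl

lemma measurable_toNat {σ : (ℕ → Y) → ℕ∞} (hσ : IsPathStoppingTime σ) :
    Measurable fun ω => (σ ω).toNat := by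
  refine measurable_to_countable' fun n => ?_
  have : (fun ω => (σ ω).toNat) ⁻¹' {n} = {ω | σ ω = n} ∪
      {ω | n = 0 ∧ ω ∈ (⋃ m : ℕ, {ω | σ ω = m})ᶜ} := by
    ext ω
    simp only [Set.mem_preimage, Set.mem_singleton_iff, Set.mem_union, Set.mem_ofPred_eq,
      Set.mem_compl_iff, Set.mem_iUnion, not_exists]
    rcases eq_or_ne (σ ω) ⊤ with h | h
    · simp [h, eq_comm]
    · lift σ ω to ℕ using h with s
      simp only [ENat.toNat_natCast, Nat.cast_inj]
      refine ⟨Or.inl, fun h => h.elim id fun h => absurd rfl (h.2 s)⟩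
  rw [this]
  refine (measurableSet_eq_nat hσ n).union ((MeasurableSet.const _).inter ?_)
  exact (MeasurableSet.iUnion fun m => measurableSet_eq_nat hσ m).compl

lemma measurable_shift_comp {r : (ℕ → Y) → ℕ} (hr : Measurable r) :
    Measurable fun ω => shift (r ω) ω :=
  (measurable_from_prod_countable_right (f := fun z : ℕ × (ℕ → Y) => shift z.1 z.2)
    fun n => measurable_shift n).comp (hr.prodMk measurable_id)

/-- The state at the stopping time `σ` (the initial state where `σ = ∞`). -/
def stateAt {Z : Type*} (σ : (ℕ → Z) → ℕ∞) (ω : ℕ → Z) : Z := ω (σ ω).toNat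

lemma measurable_stateAt {σ : (ℕ → Y) → ℕ∞} (hσ : IsPathStoppingTime σ) :
    Measurable (stateAt σ) :=
  (measurable_pi_apply 0).comp (measurable_shift_comp (measurable_toNat hσ))

variable {X : Type*} [MeasurableSpace X] [DiscreteMeasurableSpace X]

lemma measurableSet_piLE_eval (n : ℕ) (B : Set X) :
    MeasurableSet[Filtration.piLE (X := fun _ : ℕ => X) n] {ω : ℕ → X | ω n ∈ B} :=
  ⟨(fun h : (i : Set.Iic n) → X => h ⟨n, Set.mem_Iic.2 le_rfl⟩) ⁻¹' B,
    (MeasurableSet.of_discrete (s := B)).preimage (measurable_pi_apply _), rfl⟩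

/-- Gives adaptedness of `stoppedSeq` to the stopped sigma-algebras, which plain measurability would
not. -/
lemma measurable_stateAt' {σ : (ℕ → X) → ℕ∞} (hσ : IsPathStoppingTime σ) :
    Measurable[IsStoppingTime.measurableSpace hσ] (stateAt σ) := by
  intro B _
  have hn : ∀ n : ℕ, MeasurableSet[Filtration.piLE (X := fun _ : ℕ => X) n]
      ({ω | σ ω = n} ∩ {ω | ω n ∈ B}) := fun n =>
    (hσ.measurableSet_eq_of_countable n).inter (measurableSet_piLE_eval n B)
  have hle : ∀ n, Filtration.piLE (X := fun _ : ℕ => X) n ≤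
      ⨆ t, Filtration.piLE (X := fun _ : ℕ => X) t := fun n => le_iSup _ n
  constructor
  · have : stateAt σ ⁻¹' B = (⋃ n : ℕ, ({ω | σ ω = n} ∩ {ω | ω n ∈ B})) ∪
        ((⋃ m : ℕ, {ω | σ ω = m})ᶜ ∩ {ω | ω 0 ∈ B}) := by
      ext ω
      simp only [Set.mem_preimage, stateAt, Set.mem_union, Set.mem_iUnion, Set.mem_inter_iff,
        Set.mem_ofPred_eq, Set.mem_compl_iff, not_exists]
      rcases eq_or_ne (σ ω) ⊤ with h | h
      · simp [h]
      · lift σ ω to ℕ using h with s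
        simp
    rw [this]
    refine (MeasurableSet.iUnion fun n => hle n _ (hn n)).union (MeasurableSet.inter
      (MeasurableSet.iUnion fun m => hle m _ (hσ.measurableSet_eq_of_countable m)).compl
      (hle 0 _ (measurableSet_piLE_eval 0 B)))
  · intro i
    have : stateAt σ ⁻¹' B ∩ {ω | σ ω ≤ i} =
        ⋃ n ∈ Finset.Iic i, ({ω | σ ω = (n : ℕ)} ∩ {ω | ω n ∈ B}) := by
      ext ω
      simp only [Set.mem_preimage, stateAt, Set.mem_iUnion, Set.mem_inter_iff,
        Set.mem_ofPred_eq, Finset.mem_Iic]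
      rcases eq_or_ne (σ ω) ⊤ with h | h
      · rw [h]; simp
      · lift σ ω to ℕ using h with s
        constructor
        · rintro ⟨h1, h2⟩
          exact ⟨s, by exact_mod_cast h2, rfl, by simpa using h1⟩
        · rintro ⟨n, h1, h2, h3⟩
          obtain rfl : s = n := by exact_mod_cast h2
          exact ⟨by simpa using h3, by exact_mod_cast h1⟩
    change MeasurableSet[Filtration.piLE (X := fun _ : ℕ => X) i] (stateAt σ ⁻¹' B ∩ {ω | σ ω ≤ (i : ℕ∞)})
    rw [this]
    refine MeasurableSet.biUnion (Set.to_countable _) fun n hnn => ?_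
    exact Filtration.mono _ (Finset.mem_Iic.1 hnn) _ (hn n)

variable [Countable X]

/-- The strong Markov property at an almost surely finite stopping time. -/
lemma setIntegral_shift_stoppingTime (p : X → PMF X) (x : X) {σ : (ℕ → X) → ℕ∞}
    (hσ : IsPathStoppingTime σ) (hfin : ∀ᵐ ω ∂(pathMeasure p x), σ ω ≠ ⊤)
    {f : (ℕ → X) → ℝ} (hf : Measurable f) {C : ℝ} (hC : ∀ ω, |f ω| ≤ C) {A : Set (ℕ → X)}
    (hA : MeasurableSet[IsStoppingTime.measurableSpace hσ] A) :
    ∫ ω in A, f (shift (σ ω).toNat ω) ∂(pathMeasure p x) =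
      ∫ ω in A, (∫ η, f η ∂(pathMeasure p (stateAt σ ω))) ∂(pathMeasure p x) := by
  have hAn : ∀ n : ℕ, MeasurableSet[Filtration.piLE (X := fun _ : ℕ => X) n]
      (A ∩ {ω | σ ω = n}) := fun n => by
    have : A ∩ {ω | σ ω = n} = (A ∩ {ω | σ ω ≤ n}) ∩ {ω | σ ω = n} := by
      ext ω
      exact ⟨fun h => ⟨⟨h.1, h.2.le⟩, h.2⟩, fun h => ⟨h.1.1, h.2⟩⟩
    rw [this]
    exact (hA.2 n).inter (hσ.measurableSet_eq_of_countable n)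
  -- Almost sure finiteness lets `A` be cut along the values of `σ`; on each piece the time is
  -- deterministic.
  have hset : A =ᵐ[pathMeasure p x] ⋃ n : ℕ, A ∩ {ω | σ ω = n} := by
    filter_upwards [hfin] with ω hω
    refine propext ⟨fun h => ?_, fun h => ?_⟩
    · exact Set.mem_iUnion.2 ⟨(σ ω).toNat, h, (ENat.natCast_toNat hω).symm⟩
    · obtain ⟨n, hn⟩ := Set.mem_iUnion.1 h
      exact hn.1
  have hdisj : Pairwise (Function.onFun Disjoint fun n : ℕ => A ∩ {ω | σ ω = n}) := by
    intro m n hmn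
    refine Set.disjoint_left.2 fun ω h1 h2 => hmn ?_
    exact_mod_cast h1.2.symm.trans h2.2
  have hm : ∀ n : ℕ, MeasurableSet (A ∩ {ω | σ ω = n}) := fun n => Filtration.piLE.le n _ (hAn n)
  have hg : Measurable fun y => ∫ η, f η ∂(pathMeasure p y) := measurable_of_countable _
  have hgC : ∀ y, ‖∫ η, f η ∂(pathMeasure p y)‖ ≤ C := fun y => by
    have := norm_integral_le_of_norm_le_const (μ := pathMeasure p y) (f := f) (ae_of_all _ hC)
    simpa using this
  rw [setIntegral_congr_set hset, setIntegral_congr_set hset,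
    integral_iUnion hm hdisj, integral_iUnion hm hdisj]
  · refine tsum_congr fun n => ?_
    rw [setIntegral_congr_fun (g := fun ω => f (shift n ω)) (hm n), setIntegral_shift p x n hf hC (hAn n)]
    · refine setIntegral_congr_fun (hm n) fun ω hω => ?_
      simp only [stateAt, show σ ω = n from hω.2, ENat.toNat_natCast]
    · intro ω hω
      simp only [show σ ω = n from hω.2, ENat.toNat_natCast]
  · exact (Integrable.of_bound (hg.comp (measurable_stateAt hσ)).aestronglyMeasurable C
      (ae_of_all _ fun ω => hgC _)).integrableOn
  · exact (Integrable.of_bound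
      (hf.comp (measurable_shift_comp (measurable_toNat hσ))).aestronglyMeasurable C
      (ae_of_all _ fun ω => hC _)).integrableOn

end StoppingTime

/-! ### The bounded martingale along the iterated times and its limit. -/

section Martingale

variable {X : Type*} [MeasurableSpace X] [DiscreteMeasurableSpace X] [Countable X]

/-- By the strong Markov property at `τ_k`, the chain restarted there has `τ` finite almost surely,
whatever its state. -/
lemma iterTime_ae_ne_top {p : X → PMF X} {τ : (ℕ → X) → ℕ∞} (hτ : IsPathStoppingTime τ)
    (hfin : ∀ x, ∀ᵐ ω ∂(pathMeasure p x), τ ω ≠ ⊤) (x : X) :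
    ∀ᵐ ω ∂(pathMeasure p x), ∀ k, iterTime τ k ω ≠ ⊤ := by
  refine ae_all_iff.2 fun k => ?_
  induction k with
  | zero => exact ae_of_all _ fun ω => by simp [iterTime]
  | succ k ih =>
    have hm := measurableSet_eq_top hτ
    let f : (ℕ → X) → ℝ := Set.indicator {ω | τ ω = ⊤} 1
    have hf : Measurable f := measurable_one.indicator hm
    have hf0 : ∀ ω, 0 ≤ f ω := fun ω => Set.indicator_nonneg (fun _ _ => zero_le_one) ω
    have hf1 : ∀ ω, |f ω| ≤ 1 := fun ω => by
      rw [abs_of_nonneg (hf0 ω)]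
      exact Set.indicator_le_self' (fun _ _ => zero_le_one) ω
    have hσ := isPathStoppingTime_iterTime hτ k
    have h1 := setIntegral_shift_stoppingTime p x hσ ih hf hf1 MeasurableSet.univ
    have h2 : ∀ y, ∫ η, f η ∂(pathMeasure p y) = 0 := fun y => by
      refine integral_eq_zero_of_ae ?_
      filter_upwards [hfin y] with η hη
      exact Set.indicator_of_notMem (s := {ω | τ ω = ⊤}) hη _
    simp only [h2, integral_zero, setIntegral_univ] at h1
    rw [integral_eq_zero_iff_of_nonneg (fun ω => hf0 _) (Integrable.of_bound
      (hf.comp (measurable_shift_comp (measurable_toNat hσ))).aestronglyMeasurable 1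
      (ae_of_all _ fun ω => hf1 _))] at h1
    filter_upwards [ih, h1] with ω h3 h4 h5
    rw [iterTime, ENat.add_eq_top] at h5
    have h6 := h5.resolve_left h3
    simp only [f, Pi.zero_apply] at h4
    rw [Set.indicator_of_mem (s := {ω | τ ω = ⊤}) h6] at h4
    exact one_ne_zero h4

/-- A bounded `p^τ`-harmonic function is the expectation of its value at the time `τ`. -/
lemma integral_stateAt {p : X → PMF X} {τ : (ℕ → X) → ℕ∞} (hτ : IsPathStoppingTime τ)
    (hfin : ∀ x, ∀ᵐ ω ∂(pathMeasure p x), τ ω ≠ ⊤) {u : X → ℝ} {C : ℝ} (hC : ∀ x, |u x| ≤ C)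
    (hu : IsHarmonic (transformed p τ) u) (x : X) :
    ∫ ω, u (stateAt τ ω) ∂(pathMeasure p x) = u x := by
  have hm := measurable_stateAt hτ
  have := Measure.isProbabilityMeasure_map (μ := pathMeasure p x) hm.aemeasurable
  have h1 := hasSum_integral_countable ((pathMeasure p x).map (stateAt τ)) hC
  rw [integral_map hm.aemeasurable (measurable_of_countable u).aestronglyMeasurable] at h1
  -- Both series converge, and their weights agree: the law of `stateAt τ` is `p^τ (x, ·)`, as the
  -- default value on `τ = ∞` is charged with probability zero.
  refine h1.unique ?_
  convert hu x using 4 with y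
  rw [Measure.map_apply hm (measurableSet_singleton y)]
  refine measure_congr ?_
  filter_upwards [hfin x] with ω hω
  refine propext ⟨fun h => ⟨(τ ω).toNat, (ENat.natCast_toNat hω).symm, h⟩, ?_⟩
  rintro ⟨k, h1, h2⟩
  change ω (τ ω).toNat = y
  rw [h1, ENat.toNat_natCast, h2]

/-- The values of `u` at the times `τ_k`. -/
def stoppedSeq {Y : Type*} (τ : (ℕ → Y) → ℕ∞) (u : Y → ℝ) (k : ℕ) (ω : ℕ → Y) : ℝ :=
  u (stateAt (iterTime τ k) ω)

lemma stoppedSeq_add {Y : Type*} (τ : (ℕ → Y) → ℕ∞) (u : Y → ℝ) {m t : ℕ} {ω : ℕ → Y}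
    (h : iterTime τ m ω = t) {k : ℕ} (hk : iterTime τ (m + k) ω ≠ ⊤) :
    stoppedSeq τ u (m + k) ω = stoppedSeq τ u k (shift t ω) := by
  have h1 := iterTime_add τ h k
  simp only [stoppedSeq, stateAt, h1]
  have h2 : iterTime τ k (shift t ω) ≠ ⊤ := fun h2 => hk (by simp [h1, h2])
  lift iterTime τ k (shift t ω) to ℕ using h2 with s
  rw [← Nat.cast_add, ENat.toNat_natCast, ENat.toNat_natCast]
  rfl

lemma measurable_stoppedSeq {τ : (ℕ → X) → ℕ∞} (hτ : IsPathStoppingTime τ) (u : X → ℝ) (k : ℕ) :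
    Measurable (stoppedSeq τ u k) :=
  (measurable_of_countable u).comp (measurable_stateAt (isPathStoppingTime_iterTime hτ k))

/-- The filtration of the sigma-algebras of the stopping times `τ_k`. -/
def iterFiltration {τ : (ℕ → X) → ℕ∞} (hτ : IsPathStoppingTime τ) :
    Filtration ℕ (MeasurableSpace.pi : MeasurableSpace (ℕ → X)) where
  seq k := IsStoppingTime.measurableSpace (isPathStoppingTime_iterTime hτ k)
  mono' _ _ hij := IsStoppingTime.measurableSpace_mono _ _ (iterTime_mono τ hij)
  le' _ := IsStoppingTime.measurableSpace_le _

lemma integrable_stoppedSeq (p : X → PMF X) {τ : (ℕ → X) → ℕ∞} (hτ : IsPathStoppingTime τ)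
    {u : X → ℝ} {C : ℝ} (hC : ∀ x, |u x| ≤ C) (x : X) (k : ℕ) :
    Integrable (stoppedSeq τ u k) (pathMeasure p x) :=
  Integrable.of_bound (measurable_stoppedSeq hτ u k).aestronglyMeasurable C
    (ae_of_all _ fun _ => hC _)

lemma martingale_stoppedSeq {p : X → PMF X} {τ : (ℕ → X) → ℕ∞} (hτ : IsPathStoppingTime τ)
    (hfin : ∀ x, ∀ᵐ ω ∂(pathMeasure p x), τ ω ≠ ⊤) {u : X → ℝ} {C : ℝ} (hC : ∀ x, |u x| ≤ C)
    (hu : IsHarmonic (transformed p τ) u) (x : X) :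
    Martingale (stoppedSeq τ u) (iterFiltration hτ) (pathMeasure p x) := by
  refine martingale_of_setIntegral_eq_succ (fun k => ?_) (integrable_stoppedSeq p hτ hC x)
    fun k A hA => ?_
  · refine Measurable.stronglyMeasurable ?_
    exact (measurable_of_countable u).comp
      (measurable_stateAt' (isPathStoppingTime_iterTime hτ k))
  · have hall := iterTime_ae_ne_top hτ hfin x
    have hσ := isPathStoppingTime_iterTime hτ k
    have hf : Measurable fun ω => u (stateAt τ ω) :=
      (measurable_of_countable u).comp (measurable_stateAt hτ)
    have h1 := setIntegral_shift_stoppingTime p x hσ (hall.mono fun ω h => h k) hf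
      (fun ω => hC _) hA
    simp only [integral_stateAt hτ hfin hC hu] at h1
    refine h1.symm.trans (setIntegral_congr_ae ((iterFiltration hτ).le k _ hA) ?_)
    filter_upwards [hall] with ω hω _
    rw [stoppedSeq_add τ u (ENat.natCast_toNat (hω k)).symm (hω (k + 1))]
    simp [stoppedSeq, stateAt, iterTime, shift_zero]

/-- The limit of `u` along the times `τ_k`. -/
noncomputable def stoppedLim {Y : Type*} (τ : (ℕ → Y) → ℕ∞) (u : Y → ℝ) (ω : ℕ → Y) : ℝ :=
  limsup (fun k => stoppedSeq τ u k ω) atTop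

lemma measurable_stoppedLim {τ : (ℕ → X) → ℕ∞} (hτ : IsPathStoppingTime τ) (u : X → ℝ) :
    Measurable (stoppedLim τ u) :=
  Measurable.limsup fun k => measurable_stoppedSeq hτ u k

lemma limsup_mem_Icc {f : ℕ → ℝ} {a b : ℝ} (hf : ∀ n, f n ∈ Set.Icc a b) :
    limsup f atTop ∈ Set.Icc a b := by
  have h1 : IsBoundedUnder (· ≤ ·) atTop f := isBoundedUnder_of ⟨b, fun n => (hf n).2⟩
  have h2 : IsBoundedUnder (· ≥ ·) atTop f := isBoundedUnder_of ⟨a, fun n => (hf n).1⟩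
  exact ⟨le_limsup_of_frequently_le (Frequently.of_forall fun n => (hf n).1) h1,
    limsup_le_of_le h2.isCoboundedUnder_le (Eventually.of_forall fun n => (hf n).2)⟩

/-- Bounded martingale convergence: expectations pass to the limit by domination, and all of them
equal the one at `k = 0`, where the value is `u(x)`. -/
lemma integral_stoppedLim {p : X → PMF X} {τ : (ℕ → X) → ℕ∞} (hτ : IsPathStoppingTime τ)
    (hfin : ∀ x, ∀ᵐ ω ∂(pathMeasure p x), τ ω ≠ ⊤) {u : X → ℝ} {C : ℝ} (hC : ∀ x, |u x| ≤ C)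
    (hu : IsHarmonic (transformed p τ) u) (x : X) :
    ∫ ω, stoppedLim τ u ω ∂(pathMeasure p x) = u x := by
  have hM := martingale_stoppedSeq hτ hfin hC hu x
  have hC0 : 0 ≤ C := (abs_nonneg _).trans (hC x)
  have hconv : ∀ᵐ ω ∂(pathMeasure p x),
      Tendsto (fun k => stoppedSeq τ u k ω) atTop (nhds (stoppedLim τ u ω)) := by
    have := hM.submartingale.exists_ae_tendsto_of_bdd (R := C.toNNReal) fun k => by
      refine (eLpNorm_le_of_ae_bound (C := C) (ae_of_all _ fun ω => hC _)).trans ?_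
      simp [ENNReal.ofReal]
    filter_upwards [this] with ω ⟨c, hc⟩
    rwa [stoppedLim, hc.limsup_eq]
  have hlim := tendsto_integral_of_dominated_convergence (fun _ => C)
    (fun k => (measurable_stoppedSeq hτ u k).aestronglyMeasurable) (integrable_const C)
    (fun k => ae_of_all _ fun ω => hC _) hconv
  refine tendsto_nhds_unique hlim (tendsto_const_nhds.congr fun k => ?_)
  have h0 := hM.setIntegral_eq (Nat.zero_le k) MeasurableSet.univ
  rw [setIntegral_univ, setIntegral_univ] at h0
  rw [← h0, integral_congr_ae (g := fun _ => u x)]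
  · simp
  · filter_upwards [pathMeasure_ae_zero p x] with ω hω
    simp [stoppedSeq, stateAt, iterTime, hω]

end Martingale

/-! ### Tail functions from limits along shifts, and steadiness. -/

section Tail

/-- The upper limit of `W` along the shifts by `φ j - n`. -/
noncomputable def shiftLimsup {Y : Type*} (W : (ℕ → Y) → ℝ) (φ : ℕ → ℕ) (n : ℕ) (ω : ℕ → Y) : ℝ :=
  limsup (fun j => W (shift (φ j - n) ω)) atTop

lemma shiftLimsup_shift {Y : Type*} (W : (ℕ → Y) → ℝ) {φ : ℕ → ℕ} (hφ : StrictMono φ) (n k : ℕ)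
    (ω : ℕ → Y) : shiftLimsup W φ (n + k) (shift k ω) = shiftLimsup W φ n ω := by
  refine limsup_congr ?_
  -- Once `φ j ≥ n + k` the truncated subtractions are genuine, and a limsup ignores the earlier
  -- `j`.
  filter_upwards [hφ.tendsto_atTop.eventually_ge_atTop (n + k)] with j hj
  rw [shift_shift, show k + (φ j - (n + k)) = φ j - n by omega]

lemma measurable_shiftLimsup {Y : Type*} [MeasurableSpace Y] {W : (ℕ → Y) → ℝ} (hW : Measurable W)
    (φ : ℕ → ℕ) (n : ℕ) : Measurable (shiftLimsup W φ n) :=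
  Measurable.limsup fun j => hW.comp (measurable_shift (φ j - n))

/-- For each `k` the function factors through the shift by `k`, namely as `shiftLimsup W φ k` after
it. -/
lemma measurable_tailSigma_shiftLimsup {Y : Type*} [MeasurableSpace Y] {W : (ℕ → Y) → ℝ}
    (hW : Measurable W) {φ : ℕ → ℕ} (hφ : StrictMono φ) :
    Measurable[tailSigma Y] (shiftLimsup W φ 0) := by
  intro B hB
  rw [MeasurableSpace.measurableSet_iInf]
  intro k
  refine ⟨shiftLimsup W φ k ⁻¹' B, measurable_shiftLimsup hW φ k hB, ?_⟩
  ext ω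
  have := shiftLimsup_shift W hφ 0 k ω
  rw [zero_add] at this
  simp only [Set.mem_preimage, this]

variable {X : Type*} [MeasurableSpace X] [DiscreteMeasurableSpace X] [Countable X]

/-- Under `P_x` the shifted path has the law `∑_y p (x, y) P_y`; hence the property is required
under every starting point. -/
lemma ae_shift {p : X → PMF X} {P : (ℕ → X) → Prop} (hP : MeasurableSet {ω | P ω})
    (h : ∀ x, ∀ᵐ ω ∂(pathMeasure p x), P ω) (x : X) : ∀ᵐ ω ∂(pathMeasure p x), P (shift 1 ω) := by
  have hm : MeasurableSet {ω | P ω}ᶜ := hP.compl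
  let f : (ℕ → X) → ℝ := Set.indicator {ω | P ω}ᶜ 1
  have hf : Measurable f := measurable_one.indicator hm
  have hf0 : ∀ ω, 0 ≤ f ω := fun ω => Set.indicator_nonneg (fun _ _ => zero_le_one) ω
  have hf1 : ∀ ω, |f ω| ≤ 1 := fun ω => by
    rw [abs_of_nonneg (hf0 ω)]
    exact Set.indicator_le_self' (fun _ _ => zero_le_one) ω
  have h2 : ∀ y, ∫ η, f η ∂(pathMeasure p y) = 0 := fun y => by
    refine integral_eq_zero_of_ae ?_
    filter_upwards [h y] with η hη
    exact Set.indicator_of_notMem (s := {ω | P ω}ᶜ) (fun h => h hη) _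
  have h1 := hasSum_integral_shift p x hf hf1
  simp only [h2, mul_zero] at h1
  have h3 := h1.unique hasSum_zero
  rw [integral_eq_zero_iff_of_nonneg (fun ω => hf0 _) (Integrable.of_bound
    (hf.comp (measurable_shift 1)).aestronglyMeasurable 1 (ae_of_all _ fun ω => hf1 _))] at h3
  filter_upwards [h3] with ω h4
  by_contra h5
  simp only [f, Pi.zero_apply] at h4
  rw [Set.indicator_of_mem (s := {ω | P ω}ᶜ) h5] at h4
  exact one_ne_zero h4

/-- If `p` is steady, then tail measurable functions are almost surely shift invariant. -/
lemma IsSteady.ae_comp_shift_eq {p : X → PMF X} (hp : IsSteady p) {V : (ℕ → X) → ℝ}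
    (hV : Measurable[tailSigma X] V) (x : X) :
    ∀ᵐ ω ∂(pathMeasure p x), V (shift 1 ω) = V ω := by
  -- Each superlevel set agrees up to a null set with an invariant set `B`; countably many rational
  -- levels suffice to compare `V` and `V ∘ S`.
  have key : ∀ q : ℚ, ∀ᵐ ω ∂(pathMeasure p x), ((q : ℝ) < V (shift 1 ω) ↔ (q : ℝ) < V ω) := by
    intro q
    have hA : MeasurableSet[tailSigma X] {ω | (q : ℝ) < V ω} := hV measurableSet_Ioi
    have hA' : {ω | (q : ℝ) < V ω} ∈ completion p (invariantSigma X) := by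
      rw [← show completion p (tailSigma X) = completion p (invariantSigma X) from hp]
      exact ⟨_, hA, fun x => by simp⟩
    obtain ⟨B, hB, hAB⟩ := hA'
    rw [MeasurableSpace.measurableSet_invariants] at hB
    have hmA : MeasurableSet {ω | (q : ℝ) < V ω} := by
      obtain ⟨t, ht, h⟩ := MeasurableSpace.measurableSet_iInf.1 hA 0
      rw [← h]
      exact measurable_shift 0 ht
    have h1 : ∀ y, ∀ᵐ ω ∂(pathMeasure p y), ((q : ℝ) < V ω ↔ ω ∈ B) := fun y =>
      eventuallyEq_set.1 (measure_symmDiff_eq_zero_iff.1 (hAB y))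
    have hm : MeasurableSet {ω | (q : ℝ) < V ω ↔ ω ∈ B} := by
      have : {ω | (q : ℝ) < V ω ↔ ω ∈ B} = (symmDiff {ω | (q : ℝ) < V ω} B)ᶜ := by
        ext ω
        simp only [Set.mem_ofPred_eq, Set.mem_compl_iff, Set.mem_symmDiff]
        tauto
      rw [this]
      exact (hmA.symmDiff hB.1).compl
    filter_upwards [h1 x, ae_shift hm h1 x] with ω h2 h3
    rw [h2, h3]
    exact Set.ext_iff.1 hB.2 ω
  filter_upwards [ae_all_iff.2 key] with ω hω
  refine le_antisymm (le_of_forall_rat_lt_imp_le fun q hq => ((hω q).1 hq).le)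
    (le_of_forall_rat_lt_imp_le fun q hq => ((hω q).2 hq).le)

end Tail

/-! ### From asymptotic recovery to a tail version of the limit. -/

section Recovery

variable {X : Type*} [MeasurableSpace X] [DiscreteMeasurableSpace X] [Countable X]

/-- The limit of `u` along the times `τ_k` is unchanged by the shift by one of these times. -/
lemma stoppedLim_shift {Y : Type*} {τ : (ℕ → Y) → ℕ∞} (u : Y → ℝ) {ω : ℕ → Y}
    (hω : ∀ k, iterTime τ k ω ≠ ⊤) {m t : ℕ} (h : iterTime τ m ω = t) :
    stoppedLim τ u (shift t ω) = stoppedLim τ u ω := by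
  simp only [stoppedLim]
  rw [← limsup_nat_add (fun k => stoppedSeq τ u k ω) m]
  congr 1
  funext k
  rw [add_comm k m, stoppedSeq_add τ u h (hω _)]

/-- The infimum over `x` in the recovery condition allows one `W` and one `φ` to serve all starting
points. -/
lemma AsymptoticallyRecovered.exists_tail_version {p : X → PMF X} {τ : (ℕ → X) → ℕ∞}
    (hrec : AsymptoticallyRecovered p τ) (hτ : IsPathStoppingTime τ)
    (hfin : ∀ x, ∀ᵐ ω ∂(pathMeasure p x), τ ω ≠ ⊤) (u : X → ℝ) {a b : ℝ}
    (hab : ∀ x, u x ∈ Set.Icc a b) :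
    ∃ (W : (ℕ → X) → ℝ) (φ : ℕ → ℕ), Measurable W ∧ (∀ ω, W ω ∈ Set.Icc a b) ∧ StrictMono φ ∧
      ∀ x, shiftLimsup W φ 0 =ᵐ[pathMeasure p x] stoppedLim τ u := by
  obtain ⟨ρ, hρ, hlim⟩ := hrec
  set E : ℕ → Set (ℕ → X) := fun n =>
    {ω | ∃ k : ℕ, iterTime τ k ω = ((n + ρ (shift n ω) : ℕ) : ℕ∞)} with hE
  have hEm : ∀ n, MeasurableSet (E n) := by
    intro n
    have : E n = ⋃ (k : ℕ) (t : ℕ), {ω | iterTime τ k ω = t} ∩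
        (fun ω => n + ρ (shift n ω)) ⁻¹' {t} := by
      ext ω
      simp only [hE, Set.mem_ofPred_eq, Set.mem_iUnion, Set.mem_inter_iff, Set.mem_preimage,
        Set.mem_singleton_iff]
      exact exists_congr fun k => ⟨fun h => ⟨_, h, rfl⟩, fun ⟨t, h1, h2⟩ => h2 ▸ h1⟩
    rw [this]
    refine MeasurableSet.iUnion fun k => MeasurableSet.iUnion fun t => MeasurableSet.inter
      (measurableSet_eq_nat (isPathStoppingTime_iterTime hτ k) t) ?_
    exact ((hρ.comp (measurable_shift n)).const_add n) (measurableSet_singleton t)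
  -- A limsup equal to 1 exceeds each `1 - 2⁻ʲ` infinitely often; the errors `2⁻ʲ` are summable, as
  -- Borel–Cantelli needs.
  have hfreq : ∀ j : ℕ, ∃ᶠ n in atTop, 1 - (2⁻¹ : ℝ≥0∞) ^ j < ⨅ x, pathMeasure p x (E n) := by
    intro j
    refine frequently_lt_of_lt_limsup (by isBoundedDefault) ?_
    rw [hlim]
    exact ENNReal.sub_lt_self ENNReal.one_ne_top one_ne_zero (by simp)
  obtain ⟨φ, hφ, hφE⟩ := extraction_forall_of_frequently hfreq
  refine ⟨fun ω => stoppedLim τ u (shift (ρ ω) ω), φ,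
    (measurable_stoppedLim hτ u).comp (measurable_shift_comp hρ),
    fun ω => limsup_mem_Icc fun k => hab _, hφ, fun x => ?_⟩
  have hsum : ∑' j, pathMeasure p x (E (φ j))ᶜ ≠ ∞ := by
    refine ne_top_of_le_ne_top (b := ∑' j : ℕ, (2⁻¹ : ℝ≥0∞) ^ j) ?_
      (ENNReal.tsum_le_tsum fun j => ?_)
    · rw [ENNReal.tsum_geometric]
      simp
    · rw [prob_compl_eq_one_sub (hEm _)]
      exact tsub_le_iff_tsub_le.1 ((hφE j).le.trans (iInf_le _ x))
  filter_upwards [ae_eventually_notMem hsum, iterTime_ae_ne_top hτ hfin x] with ω hω hfinω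
  have : ∀ᶠ j in atTop, stoppedLim τ u (shift (ρ (shift (φ j - 0) ω)) (shift (φ j - 0) ω)) =
      stoppedLim τ u ω := by
    filter_upwards [hω] with j hj
    obtain ⟨k, hk⟩ := Set.notMem_compl_iff.1 hj
    rw [Nat.sub_zero, shift_shift]
    exact stoppedLim_shift u hfinω hk
  rw [shiftLimsup, limsup_congr this, limsup_const]

/-- If `p` is steady, then the bounded `p^τ`-harmonic functions are `p`-harmonic. -/
lemma IsSteady.isHarmonic_of_tail_version {p : X → PMF X} (hp : IsSteady p) {u : X → ℝ}
    {V : (ℕ → X) → ℝ} (hV : Measurable[tailSigma X] V) (hVm : Measurable V) {C : ℝ}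
    (hC : ∀ ω, |V ω| ≤ C) (hVu : ∀ x, ∫ ω, V ω ∂(pathMeasure p x) = u x) :
    IsHarmonic (fun x y => p x y) u := by
  intro x
  have h := hasSum_integral_shift p x hVm hC
  rw [integral_congr_ae (hp.ae_comp_shift_eq hV x)] at h
  simpa only [hVu] using h

end Recovery

end MarkovStopping

/-! ### The main theorem. -/

open MarkovStopping

theorem theorem5p1 {X : Type*} [Countable X] [MeasurableSpace X] [DiscreteMeasurableSpace X]
    (p : X → PMF X)
    (hp : MarkovStopping.IsTransient p)
    (o : X) (ho : ∀ y, 0 < MarkovStopping.green p o y)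
    (τ : (ℕ → X) → ℕ∞)
    (hτ : MarkovStopping.IsPathStoppingTime τ)
    (hτ_fin : ∀ x, MarkovStopping.pathMeasure p x {ω | τ ω < ⊤} = 1)
    (hτ_rec : MarkovStopping.AsymptoticallyRecovered p τ)
    (u : X → ℝ) (hu_nonneg : ∀ x, 0 ≤ u x) (hu_bdd : MarkovStopping.IsBdd u)
    (hu : MarkovStopping.IsHarmonic (MarkovStopping.transformed p τ) u) :
    (∃ ubar : X × ℕ → ℝ,
      (∀ x, ubar (x, 0) = u x) ∧
      (∀ z, 0 ≤ ubar z) ∧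
      MarkovStopping.IsBdd ubar ∧
      MarkovStopping.IsHarmonicSeq p ubar ∧
      MarkovStopping.supNorm ubar = MarkovStopping.supNorm u ∧
      (MarkovStopping.IsSteady p → ∀ x n, ubar (x, n) = u x)) ∧
    (MarkovStopping.IsSteady p → MarkovStopping.IsHarmonic (fun x y => p x y) u) := by
  have : Nonempty X := ⟨o⟩
  have hfin : ∀ x, ∀ᵐ ω ∂(pathMeasure p x), τ ω ≠ ⊤ := fun x => by
    have hm : MeasurableSet {ω | τ ω < ⊤} := by
      have := (measurableSet_eq_top hτ).compl
      convert this using 1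
      ext ω
      simp [lt_top_iff_ne_top]
    have h1 := (prob_compl_eq_zero_iff hm).2 (hτ_fin x)
    filter_upwards [compl_mem_ae_iff.2 h1] with ω hω
    simpa [lt_top_iff_ne_top] using hω
  have hbdd : BddAbove (Set.range fun x => |u x|) := by
    obtain ⟨C, hC⟩ := hu_bdd
    exact ⟨C, by rintro _ ⟨x, rfl⟩; exact hC x⟩
  set M := supNorm u with hM
  have huM : ∀ x, |u x| ≤ M := fun x => le_ciSup hbdd x
  have hIcc : ∀ x, u x ∈ Set.Icc 0 M := fun x => ⟨hu_nonneg x, (le_abs_self _).trans (huM x)⟩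
  obtain ⟨W, φ, hW, hWI, hφ, hWU⟩ := hτ_rec.exists_tail_version hτ hfin u hIcc
  have hVI : ∀ n ω, shiftLimsup W φ n ω ∈ Set.Icc 0 M := fun n ω => limsup_mem_Icc fun j => hWI _
  have hVM : ∀ n ω, |shiftLimsup W φ n ω| ≤ M := fun n ω => by
    rw [abs_of_nonneg (hVI n ω).1]
    exact (hVI n ω).2
  have hVm : ∀ n, Measurable (shiftLimsup W φ n) := measurable_shiftLimsup hW φ
  have hVu : ∀ x, ∫ ω, shiftLimsup W φ 0 ω ∂(pathMeasure p x) = u x := fun x => by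
    rw [integral_congr_ae (hWU x), integral_stoppedLim hτ hfin huM hu]
  have hsteady : IsSteady p → IsHarmonic (fun x y => p x y) u := fun hs =>
    hs.isHarmonic_of_tail_version (measurable_tailSigma_shiftLimsup hW hφ) (hVm 0) (hVM 0) hVu
  -- The lower bound comes from the slice `n = 0`, where `v` is `u`.
  have hsup : ∀ v : X × ℕ → ℝ, (∀ x, v (x, 0) = u x) → (∀ z, |v z| ≤ M) → supNorm v = M := by
    intro v h0 hv
    refine le_antisymm (ciSup_le hv) (ciSup_le fun x => ?_)
    rw [← h0 x]
    exact le_ciSup (f := fun z => |v z|) ⟨M, by rintro _ ⟨z, rfl⟩; exact hv z⟩ (x, 0)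
  refine ⟨?_, hsteady⟩
  -- In the steady case the sequence constant in `n` has all the properties; otherwise the last
  -- requirement is vacuous and the expectations of the `V_n` are used.
  by_cases hs : IsSteady p
  · exact ⟨fun z => u z.1, fun _ => rfl, fun z => hu_nonneg _, ⟨M, fun z => huM _⟩,
      fun x n => hsteady hs x, hsup _ (fun _ => rfl) fun z => huM _, fun _ _ _ => rfl⟩
  · have hubar : ∀ z : X × ℕ, |∫ ω, shiftLimsup W φ z.2 ω ∂(pathMeasure p z.1)| ≤ M := fun z => by
      have := norm_integral_le_of_norm_le_const (μ := pathMeasure p z.1)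
        (f := shiftLimsup W φ z.2) (ae_of_all _ (hVM z.2))
      simpa using this
    refine ⟨fun z => ∫ ω, shiftLimsup W φ z.2 ω ∂(pathMeasure p z.1), hVu,
      fun z => integral_nonneg fun ω => (hVI _ ω).1, ⟨M, hubar⟩, fun x n => ?_,
      hsup _ hVu hubar, fun h => absurd h hs⟩
    have h := hasSum_integral_shift p x (hVm (n + 1)) (hVM (n + 1))
    simpa only [shiftLimsup_shift W hφ n 1] using h
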